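/- **Setting.** Let $M$ be a compact smooth manifold, possibly with boundary (or corners), with a finite positive Borel measure $dx$. Let $L$ be a linear operator with some domain in $L^2(M)$ (e.g. a pseudo-differential operator with boundary conditions), let $\mathcal I$ be a countable set, and let $u_\xi, v_\xi\in L^2(M)$, $\lambda_\xi\in\mathbb C$ $(\xi\in\mathcal I)$ satisfy $Lu_\xi=\lambda_\xi u_\xi$, $L^*v_\xi=\overline{\lambda_\xi}v_\xi$ and $\int_M u_\xi\overline{v_\eta}\,dx=\delta_{\xi\eta}$. Assume that $\{u_\xi\}$ is a basis of $L^2(M)$: every $f\in L^2(M)$ has a unique expansion $f=\sum_{\xi\in\mathcal I} a_\xi u_\xi$, converging (unconditionally) in $L^2(M)$. Let $C_L^\infty(M)=\bigcap_k \mathrm{Dom}(L^k)$ with the topology of the norms $\max_{j\le k}\|L^j\varphi\|_{L^2}$, $k\in\mathbb N_0$, and let $\widehat f(\xi)=\int_M f\,\overline{v_\xi}\,dx$. A continuous linear $A:C_L^\infty(M)\to C_L^\infty(M)$ is an *$L$-Fourier multiplier* with symbol $\sigma_A:\mathcal I\to\mathbb C$ if $\widehat{Af}(\xi)=\sigma_A(\xi)\widehat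 f(\xi)$ for all $f\in C_L^\infty(M)$ and $\xi\in\mathcal I$; its kernel is $K_A(x,y)=\sum_{\xi}u_\xi(x)\sigma_A(\xi)\overline{v_\xi(y)}$. For $0<r\le 1$, a bounded operator $T:E\to F$ between Banach spaces is *$r$-nuclear* if there are $x_n'\in E'$, $y_n\in F$ with $\sum_n\|x_n'\|^r\|y_n\|^r<\infty$ and $Tx=\sum_n x_n'(x)y_n$ for all $x\in E$. **Corollary 3.3.** Let $0<r\le 1$, $1\le p_1,p_2<\infty$ and $\frac1{p_1}+\frac1{q_1}=1$. Let $A$ be an $L$-Fourier multiplier with symbol $\sigma_A$ such that $$\sum_{\xi\in\mathcal I}|\sigma_A(\xi)|^r\,\|u_\xi\|_{L^{p_2}}^r\,\|v_\xi\|_{L^{q_1}}^r<\infty$$ (norms in $[0,\infty]$, with $0\cdot\infty=0$). Then there is exactly one bounded operator from $L^{p_1}(M)$ to $L^{p_2}(M)$, again denoted by $A$, that agrees with the given operator on $C_L^\infty(M)\cap L^{p_1}(M)$ and satisfies $Af(x)=\int_M K_A(x,y)f(y)\,dy$ (with absolutely convergent integral) for all $f\in L^{p_1}(M)$ and a.e.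 $x$; this operator is $r$-nuclear. Moreover, if $p_1=p_2=p$, then the trace $\mathrm{Tr}(A)=\sum_n x_n'(y_n)$ is well defined on $L^p(M)$, i.e. it has the same value for every $1$-nuclear representation $A=\sum_n x_n'\otimes y_n$; every nonzero eigenvalue of $A$ on $L^p(M)$ has finite algebraic multiplicity, the nonzero eigenvalues can be listed in a sequence $(\lambda_j(A))_{j\ge1}$ in which each is repeated according to its algebraic multiplicity (all remaining terms, if any, being $0$), and for every such sequence $$\mathrm{Tr}(A)=\sum_{\xi\in\mathcal I}\sigma_A(\xi)=\sum_{j=1}^\infty\lambda_j(A),$$ both series being absolutely convergent. -/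

import Mathlib

open MeasureTheory
open scoped ENNReal ComplexConjugate ContDiff

noncomputable section

namespace NonharmonicAnalysis

/-! ### Nuclear operators, trace, eigenvalues -/

section Nuclear

variable {E F : Type*} [NormedAddCommGroup E] [NormedSpace ℂ E]
  [NormedAddCommGroup F] [NormedSpace ℂ F]

/-- `T x = ∑ ⟨x, x'ₙ⟩ yₙ` for all `x`, with `∑ ‖x'ₙ‖ ^ r * ‖yₙ‖ ^ r < ∞`. -/
structure IsNuclearRep (r : ℝ) (T : E →L[ℂ] F) (x' : ℕ → StrongDual ℂ E) (y : ℕ → F) : Prop where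
  hasSum : ∀ x : E, HasSum (fun n => x' n x • y n) (T x)
  summable : Summable (fun n => ‖x' n‖ ^ r * ‖y n‖ ^ r)

/-- `T` is `r`-nuclear. -/
def IsRNuclear (r : ℝ) (T : E →L[ℂ] F) : Prop :=
  ∃ (x' : ℕ → StrongDual ℂ E) (y : ℕ → F), IsNuclearRep r T x' y

/-- `T` is nuclear, and its trace is well defined and equal to `t`: every nuclear representation
`T = ∑ x'ₙ ⊗ yₙ` of `T` satisfies `∑ x'ₙ(yₙ) = t`. -/
def HasNuclearTrace (T : E →L[ℂ] E) (t : ℂ) : Prop :=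
  IsRNuclear 1 T ∧
    ∀ (x' : ℕ → StrongDual ℂ E) (y : ℕ → E), IsNuclearRep 1 T x' y →
      HasSum (fun n => x' n (y n)) t

/-- The generalized eigenspace of `T` at `z`, that is `⋃ₖ ker (T - z)ᵏ`; its dimension is the
algebraic multiplicity of the eigenvalue `z`. -/
def genEigenspace (T : E →L[ℂ] E) (z : ℂ) : Submodule ℂ E :=
  Module.End.maxGenEigenspace (T : E →ₗ[ℂ] E) z

/-- The sequence `ev` lists the nonzero eigenvalues of `T`, each one repeated as many times as its
(finite) algebraic multiplicity; the remaining terms, if any, are `0`. -/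
def IsEigenvalueSequence (T : E →L[ℂ] E) (ev : ℕ → ℂ) : Prop :=
  ∀ z : ℂ, z ≠ 0 →
    FiniteDimensional ℂ (genEigenspace T z) ∧
      {j : ℕ | ev j = z}.encard = (Module.finrank ℂ (genEigenspace T z) : ℕ∞)

end Nuclear

/-! ### The test space `C_L^∞ = Dom(L^∞)` of an operator `L` with a domain in a Hilbert space -/

section TestSpace

variable {H : Type*} [NormedAddCommGroup H] [InnerProductSpace ℂ H]

/-- `Dom(L^k)`: the vectors `f` such that `f, L f, …, L^(k-1) f` all lie in the domain of `L`. -/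
def domPow (L : H →ₗ.[ℂ] H) : ℕ → Submodule ℂ H
  | 0 => ⊤
  | k + 1 => ((domPow L k).comap L.toFun).map L.domain.subtype

/-- `Dom(L^∞)`, the intersection of all `Dom(L^k)`. -/
def domInfty (L : H →ₗ.[ℂ] H) : Submodule ℂ H := ⨅ k : ℕ, domPow L k

theorem domInfty_le_domain (L : H →ₗ.[ℂ] H) : domInfty L ≤ L.domain := by
  intro f hf
  have h1 : f ∈ domPow L 1 := (Submodule.mem_iInf _).1 hf 1
  obtain ⟨g, -, rfl⟩ := h1
  exact g.2

theorem map_mem_domInfty (L : H →ₗ.[ℂ] H) (f : domInfty L) :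
    L.toFun ⟨f, domInfty_le_domain L f.2⟩ ∈ domInfty L := by
  refine (Submodule.mem_iInf _).2 fun k => ?_
  have h1 : (f : H) ∈ domPow L (k + 1) := (Submodule.mem_iInf _).1 f.2 (k + 1)
  obtain ⟨g, hg, hgf⟩ := h1
  have : (⟨f, domInfty_le_domain L f.2⟩ : L.domain) = g := Subtype.ext hgf.symm
  rw [this]
  exact hg

/-- The space of test functions `C_L^∞ = Dom(L^∞)`. It is a copy of the subspace `domInfty L` that
carries its own Fréchet topology, not the one induced by the norm. -/
def TestSpace (L : H →ₗ.[ℂ] H) : Type _ := domInfty L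

instance (L : H →ₗ.[ℂ] H) : AddCommGroup (TestSpace L) := inferInstanceAs (AddCommGroup (domInfty L))

instance (L : H →ₗ.[ℂ] H) : Module ℂ (TestSpace L) := inferInstanceAs (Module ℂ (domInfty L))

/-- The inclusion of the test space into the Hilbert space. -/
def TestSpace.incl (L : H →ₗ.[ℂ] H) : TestSpace L →ₗ[ℂ] H := (domInfty L).subtype

/-- `L` as an operator from `C_L^∞` to itself. -/
def TestSpace.op (L : H →ₗ.[ℂ] H) : TestSpace L →ₗ[ℂ] TestSpace L :=
  LinearMap.codRestrict (domInfty L)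
    (L.toFun ∘ₗ Submodule.inclusion (domInfty_le_domain L)) (map_mem_domInfty L)

/-- The norms `‖φ‖_{C_L^k} = max_{j ≤ k} ‖L^j φ‖`. -/
def TestSpace.seminormFamily (L : H →ₗ.[ℂ] H) : SeminormFamily ℂ (TestSpace L) ℕ :=
  fun k => (Finset.range (k + 1)).sup fun j =>
    (normSeminorm ℂ H).comp (TestSpace.incl L ∘ₗ (TestSpace.op L) ^ j)

/-- The Fréchet topology of `C_L^∞`, generated by the norms `‖·‖_{C_L^k}`. -/
instance (L : H →ₗ.[ℂ] H) : TopologicalSpace (TestSpace L) :=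
  (TestSpace.seminormFamily L).moduleFilterBasis.topology

end TestSpace

/-! ### Biorthogonal eigenfunction systems and Fourier multipliers -/

section Multipliers

variable {M : Type*} [MeasurableSpace M] {μ : Measure M} {ι : Type*}

/-- `u ξ` are eigenfunctions of `L` with eigenvalues `lam ξ`, `v ξ` are eigenfunctions of the
adjoint operator `L*` with the conjugate eigenvalues, the systems `u` and `v` are biorthogonal,
and `u` is a basis of `L²`. -/
structure IsBiorthogonalEigenbasis (L : Lp ℂ 2 μ →ₗ.[ℂ] Lp ℂ 2 μ) (lam : ι → ℂ)
    (u v : ι → Lp ℂ 2 μ) : Prop where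
  eigen : ∀ ξ, ∃ h : u ξ ∈ L.domain, L ⟨u ξ, h⟩ = lam ξ • u ξ
  eigen_adjoint : ∀ ξ, ∃ h : v ξ ∈ L.adjoint.domain, L.adjoint ⟨v ξ, h⟩ = conj (lam ξ) • v ξ
  pairing_self : ∀ ξ, ∫ x, u ξ x * conj (v ξ x) ∂μ = 1
  pairing_ne : ∀ ξ η, ξ ≠ η → ∫ x, u ξ x * conj (v η x) ∂μ = 0
  basis : ∀ f : Lp ℂ 2 μ, ∃! a : ι → ℂ, HasSum (fun ξ => a ξ • u ξ) f

/-- The `L`-Fourier transform `f̂(ξ) = ∫ f(x) conj(v_ξ(x)) dx`. -/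
def fourierL (v : ι → Lp ℂ 2 μ) (f : Lp ℂ 2 μ) (ξ : ι) : ℂ :=
  ∫ x, f x * conj (v ξ x) ∂μ

/-- The continuous linear operator `A : C_L^∞ → C_L^∞` is an `L`-Fourier multiplier with symbol
`σ`: `(A f)^(ξ) = σ(ξ) f̂(ξ)` for all `f` and `ξ`. -/
def IsFourierMultiplier {L : Lp ℂ 2 μ →ₗ.[ℂ] Lp ℂ 2 μ} (v : ι → Lp ℂ 2 μ)
    (A : TestSpace L →L[ℂ] TestSpace L) (σ : ι → ℂ) : Prop :=
  ∀ (f : TestSpace L) (ξ : ι),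
    fourierL v (TestSpace.incl L (A f)) ξ = σ ξ * fourierL v (TestSpace.incl L f) ξ

/-- The integral kernel `K_A(x, y) = ∑_ξ u_ξ(x) σ(ξ) conj(v_ξ(y))` of the multiplier with
symbol `σ`. -/
def kernel (u v : ι → Lp ℂ 2 μ) (σ : ι → ℂ) (x y : M) : ℂ :=
  ∑' ξ, u ξ x * σ ξ * conj (v ξ y)

/-- The bounded operator `T : L^{p₁} → L^{p₂}` is the multiplier `A` acting from `L^{p₁}` to
`L^{p₂}`: it agrees with `A` on the test functions that belong to `L^{p₁}`, and on all of `L^{p₁}`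
it is the integral operator with the kernel `K_A`. (The second condition determines `T` also
when the test functions are not dense in `L^{p₁}`.) -/
structure IsLpRealization {L : Lp ℂ 2 μ →ₗ.[ℂ] Lp ℂ 2 μ} (u v : ι → Lp ℂ 2 μ)
    (A : TestSpace L →L[ℂ] TestSpace L) (σ : ι → ℂ)
    {p₁ p₂ : ℝ≥0∞} [Fact (1 ≤ p₁)] [Fact (1 ≤ p₂)]
    (T : Lp ℂ p₁ μ →L[ℂ] Lp ℂ p₂ μ) : Prop where
  agrees : ∀ (f : TestSpace L) (g : Lp ℂ p₁ μ),
    g =ᵐ[μ] TestSpace.incl L f → T g =ᵐ[μ] TestSpace.incl L (A f)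
  kernel_eq : ∀ g : Lp ℂ p₁ μ, ∀ᵐ x ∂μ,
    Integrable (fun y => kernel u v σ x y * g y) μ ∧
      T g x = ∫ y, kernel u v σ x y * g y ∂μ

end Multipliers

end NonharmonicAnalysis

end

/-! On test functions the basis expansion gives `A f = ∑ σ ξ * f̂(ξ) • u ξ`. By Hölder each rank one
term has norm at most a constant times `|σ ξ| ‖u ξ‖ ‖v ξ‖`, so the hypothesis is precisely what
makes this series an `r`-nuclear representation from `L^{p₁}` to `L^{p₂}`. Absolute convergence also
identifies its sum with the integral operator (`exists_isLpRealization`), and the kernel formula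
gives uniqueness.

The trace is independent of the representation because `L^p`, `p < ∞`, has the metric approximation
property: conditional expectations on finite partitions are contractions of finite rank
(`hasMetricApproximation_Lp`, `IsNuclearRep.tsum_eq`). By biorthogonality the representation above
has trace `∑ σ ξ`.

No general theorem on eigenvalues of nuclear operators is needed. The operator is diagonal, and its
generalized eigenspace at `z ≠ 0` is spanned by the finitely many `u ξ` with `σ ξ = z`
(`genEigenspace_eq_span`). So an eigenvalue sequence is a rearrangement of the values of `σ`, up to
zeros. -/

namespace NonharmonicAnalysis

open Filter Topology

/-! ### Nuclear representations and independence of the trace. -/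

section Trace

variable {E F : Type*} [NormedAddCommGroup E] [NormedSpace ℂ E]
  [NormedAddCommGroup F] [NormedSpace ℂ F]

/-- The metric approximation property. -/
def HasMetricApproximation (E : Type*) [NormedAddCommGroup E] [NormedSpace ℂ E] : Prop :=
  ∀ (s : Finset E) (ε : ℝ), 0 < ε → ∃ P : E →L[ℂ] E,
    FiniteDimensional ℂ (P : E →ₗ[ℂ] E).range ∧ ‖P‖ ≤ 1 ∧ ∀ y ∈ s, ‖P y - y‖ ≤ ε

/-- A summable family indexed by a countable type gives a nuclear representation. -/
theorem isNuclearRep_extend {ι : Type*} {r : ℝ} (hr : 0 < r) {T : E →L[ℂ] F}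
    {w : ι → StrongDual ℂ E} {y : ι → F} (hT : ∀ x, HasSum (fun ξ => w ξ x • y ξ) (T x))
    (hs : Summable fun ξ => ‖w ξ‖ ^ r * ‖y ξ‖ ^ r) {e : ι → ℕ} (he : e.Injective) :
    IsNuclearRep r T (Function.extend e w 0) (Function.extend e y 0) where
  hasSum x := by
    convert (hasSum_extend_zero he).2 (hT x) using 1
    funext n
    by_cases hn : ∃ ξ, e ξ = n
    · obtain ⟨ξ, rfl⟩ := hn
      simp [he.extend_apply]
    · simp [Function.extend_apply' _ _ _ hn]
  summable := by
    convert (summable_extend_zero he).2 hs using 1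
    funext n
    by_cases hn : ∃ ξ, e ξ = n
    · obtain ⟨ξ, rfl⟩ := hn
      simp [he.extend_apply]
    · simp [Function.extend_apply' _ _ _ hn, Real.zero_rpow hr.ne']

/-- All but finitely many terms are at most `1`, and there `t ≤ t ^ r`. -/
theorem summable_of_summable_rpow {ι : Type*} {r : ℝ} (hr0 : 0 < r) (hr1 : r ≤ 1) {f : ι → ℝ}
    (hf : ∀ i, 0 ≤ f i) (hs : Summable fun i => f i ^ r) : Summable f := by
  refine Summable.of_norm_bounded_eventually hs ?_
  have h1 : ∀ᶠ i in cofinite, f i ^ r < 1 := hs.tendsto_cofinite_zero.eventually_lt_const one_pos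
  filter_upwards [h1] with i hi
  have hi1 : f i ≤ 1 := by
    by_contra! h
    exact absurd hi (not_lt.2 (Real.one_le_rpow h.le hr0.le))
  rw [Real.norm_of_nonneg (hf i)]
  exact Real.self_le_rpow_of_le_one (hf i) hi1 hr1

theorem IsNuclearRep.summable_norm_mul {T : E →L[ℂ] F} {w : ℕ → StrongDual ℂ E} {y : ℕ → F}
    (h : IsNuclearRep 1 T w y) : Summable fun n => ‖w n‖ * ‖y n‖ := by
  simpa using h.summable

/-- The trace of `P ∘ T`, computed from a nuclear representation of `T`, depends only on `T`. -/
theorem IsNuclearRep.tsum_comp_finite_rank {T : E →L[ℂ] E} {w a : ℕ → StrongDual ℂ E}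
    {y b : ℕ → E} (h : IsNuclearRep 1 T w y) (h' : IsNuclearRep 1 T a b) (P : E →L[ℂ] E)
    [FiniteDimensional ℂ (P : E →ₗ[ℂ] E).range] :
    ∑' n, w n (P (y n)) = ∑' n, a n (P (b n)) := by
  let B := Module.finBasis ℂ (P : E →ₗ[ℂ] E).range
  let Q : E →L[ℂ] (P : E →ₗ[ℂ] E).range := P.codRestrict _ fun x => ⟨x, rfl⟩
  let φ : Fin _ → StrongDual ℂ E := fun i => (LinearMap.toContinuousLinearMap (B.coord i)).comp Q
  have hP : ∀ x, P x = ∑ i, φ i x • (B i : E) := fun x => by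
    have := congrArg Subtype.val (B.sum_repr (Q x))
    rw [AddSubmonoidClass.coe_finsetSum] at this
    exact this.symm
  -- With `P = ∑ φ i ⊗ B i`, the sum is the trace of the finite rank operator `T ∘ P`, a value in
  -- which `w` and `y` no longer occur.
  have key : ∀ (w : ℕ → StrongDual ℂ E) (y : ℕ → E), IsNuclearRep 1 T w y →
      HasSum (fun n => w n (P (y n))) (∑ i, φ i (T (B i))) := by
    intro w y h
    have : ∀ i ∈ Finset.univ, HasSum (fun n => φ i (y n) * w n (B i)) (φ i (T (B i))) := by
      intro i _
      have := (φ i).hasSum (h.hasSum (B i))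
      simpa [mul_comm] using this
    convert hasSum_sum this using 2 with n
    simp [hP]
  rw [(key w y h).tsum_eq, (key a b h').tsum_eq]

/-- The two sums agree after inserting a finite rank `P`. Contractions `P N` that converge to the
identity on the vectors of both representations then allow dominated convergence, with bound `‖w n‖
* ‖y n‖`. -/
theorem IsNuclearRep.tsum_eq {T : E →L[ℂ] E} {w a : ℕ → StrongDual ℂ E}
    {y b : ℕ → E} (hE : HasMetricApproximation E)
    (h : IsNuclearRep 1 T w y) (h' : IsNuclearRep 1 T a b) :
    ∑' n, w n (y n) = ∑' n, a n (b n) := by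
  classical
  choose P hPf hPn hP using fun N : ℕ =>
    hE ((Finset.range N).image y ∪ (Finset.range N).image b) (1 / ((N : ℝ) + 1)) (by positivity)
  have lim : ∀ c : E, (∀ᶠ N : ℕ in atTop, ‖P N c - c‖ ≤ 1 / ((N : ℝ) + 1)) →
      Tendsto (fun N => P N c) atTop (𝓝 c) := by
    intro c hc
    rw [tendsto_iff_norm_sub_tendsto_zero]
    exact squeeze_zero' (Eventually.of_forall fun _ => norm_nonneg _) hc
      tendsto_one_div_add_atTop_nhds_zero_nat
  have conv : ∀ (w : ℕ → StrongDual ℂ E) (y : ℕ → E), IsNuclearRep 1 T w y →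
      (∀ k, Tendsto (fun N => P N (y k)) atTop (𝓝 (y k))) →
      Tendsto (fun N => ∑' n, w n (P N (y n))) atTop (𝓝 (∑' n, w n (y n))) := by
    intro w y h hy
    refine tendsto_tsum_of_dominated_convergence h.summable_norm_mul
      (fun k => ((w k).continuous.tendsto _).comp (hy k)) (Eventually.of_forall fun N k => ?_)
    refine ((w k).le_opNorm _).trans ?_
    gcongr
    exact ((P N).le_of_opNorm_le (hPn N) _).trans (one_mul _).le
  have h1 := conv w y h fun k => lim _ <| by
    filter_upwards [eventually_gt_atTop k] with N hN
    exact hP N _ (Finset.mem_union_left _ (Finset.mem_image_of_mem _ (Finset.mem_range.2 hN)))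
  have h2 := conv a b h' fun k => lim _ <| by
    filter_upwards [eventually_gt_atTop k] with N hN
    exact hP N _ (Finset.mem_union_right _ (Finset.mem_image_of_mem _ (Finset.mem_range.2 hN)))
  refine tendsto_nhds_unique h1 (h2.congr fun N => ?_)
  have := hPf N
  exact h'.tsum_comp_finite_rank h (P N)

theorem IsNuclearRep.hasNuclearTrace {T : E →L[ℂ] E} {w : ℕ → StrongDual ℂ E} {y : ℕ → E}
    (hE : HasMetricApproximation E) (h : IsNuclearRep 1 T w y) :
    HasNuclearTrace T (∑' n, w n (y n)) := by
  refine ⟨⟨w, y, h⟩, fun a b h' => ?_⟩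
  rw [h.tsum_eq hE h']
  exact (Summable.of_norm_bounded h'.summable_norm_mul fun n => (a n).le_opNorm _).hasSum

end Trace

/-! ### Generalized eigenspaces of diagonal operators and rearrangement of eigenvalues. -/

section Spectrum

variable {E : Type*} [NormedAddCommGroup E] [NormedSpace ℂ E] {ι : Type*}

/-- The generalized eigenspaces of a diagonal operator `∑ σ_ξ w_ξ ⊗ y_ξ`. -/
theorem genEigenspace_eq_span {T : E →L[ℂ] E} {σ : ι → ℂ} {w : ι → StrongDual ℂ E} {y : ι → E}
    (hσ : Summable σ) (hT : ∀ x, HasSum (fun ξ => σ ξ • w ξ x • y ξ) (T x))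
    (hw : ∀ ξ, σ ξ ≠ 0 → w ξ (y ξ) = 1)
    (hne : ∀ ξ η, σ ξ ≠ 0 → σ η ≠ 0 → ξ ≠ η → w ξ (y η) = 0) {z : ℂ} (hz : z ≠ 0) :
    genEigenspace T z = Submodule.span ℂ (Set.range fun ξ : {ξ // σ ξ = z} => y ξ) := by
  have hfin : {ξ | σ ξ = z}.Finite := by
    have := hσ.tendsto_cofinite_zero.eventually_ne hz.symm
    simpa using this
  have hTw : ∀ ξ, σ ξ ≠ 0 → ∀ x, w ξ (T x) = σ ξ * w ξ x := by
    intro ξ hξ x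
    have h1 := (w ξ).hasSum (hT x)
    refine h1.unique ?_
    convert hasSum_single ξ _ using 1
    · simp [hw ξ hξ]
    · intro η hη
      by_cases h0 : σ η = 0
      · simp [h0]
      · simp [hne ξ η hξ h0 hη.symm]
  have hTy : ∀ ξ, σ ξ ≠ 0 → T (y ξ) = σ ξ • y ξ := by
    intro ξ hξ
    refine (hT (y ξ)).unique ?_
    convert hasSum_single ξ _ using 1
    · simp [hw ξ hξ]
    · intro η hη
      by_cases h0 : σ η = 0
      · simp [h0]
      · simp [hne η ξ h0 hξ hη]
  set S := Submodule.span ℂ (Set.range fun ξ : {ξ // σ ξ = z} => y ξ) with hS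
  apply le_antisymm
  · intro f hf
    obtain ⟨k, hk⟩ := (Module.End.mem_maxGenEigenspace _ _ _).1 hf
    -- The functional `w ξ` turns `T - z` into multiplication by `σ ξ - z`, so it kills `g` unless
    -- `σ ξ` is `0` or `z`. The series for `T g` thus reduces to finitely many terms in `S`.
    have hTS : ∀ g : E, (((T : E →ₗ[ℂ] E) - z • (1 : Module.End ℂ E)) ^ k) g = 0 → T g ∈ S := by
      intro g hg
      have hzero : ∀ ξ, σ ξ ≠ 0 → σ ξ ≠ z → w ξ g = 0 := by
        intro ξ h0 h1
        have : ∀ (n : ℕ) (x : E), w ξ ((((T : E →ₗ[ℂ] E) - z • (1 : Module.End ℂ E)) ^ n) x)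
            = (σ ξ - z) ^ n * w ξ x := by
          intro n
          induction n with
          | zero => simp
          | succ n ih =>
            intro x
            rw [pow_succ, Module.End.mul_apply, ih]
            simp [hTw ξ h0 x]
            ring
        have h2 := this k g
        rw [hg, map_zero, eq_comm, mul_eq_zero] at h2
        exact h2.resolve_left (pow_ne_zero _ (sub_ne_zero.2 h1))
      have h1 := hT g
      have h2 : HasSum (fun ξ => σ ξ • w ξ g • y ξ)
          (∑ ξ ∈ hfin.toFinset, σ ξ • w ξ g • y ξ) := by
        refine hasSum_sum_of_ne_finset_zero fun ξ hξ => ?_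
        by_cases h0 : σ ξ = 0
        · simp [h0]
        · simp [hzero ξ h0 (by simpa using hξ)]
      rw [h1.unique h2]
      refine Submodule.sum_mem _ fun ξ hξ => ?_
      exact Submodule.smul_mem _ _ (Submodule.smul_mem _ _
        (Submodule.subset_span ⟨⟨ξ, by simpa using hξ⟩, rfl⟩))
    -- Only `T g`, not `g`, has a series expansion; `z • g = T g - (T - z) g` with `z ≠ 0` recovers
    -- `g` by induction on the power.
    have main : ∀ (n : ℕ) (g : E),
        (((T : E →ₗ[ℂ] E) - z • (1 : Module.End ℂ E)) ^ k) g = 0 →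
        (((T : E →ₗ[ℂ] E) - z • (1 : Module.End ℂ E)) ^ n) g ∈ S → g ∈ S := by
      intro n
      induction n with
      | zero => intro g _ h; simpa using h
      | succ n ih =>
        intro g hg h
        have h1 : (((T : E →ₗ[ℂ] E) - z • (1 : Module.End ℂ E))) g ∈ S := by
          refine ih _ ?_ (by rwa [pow_succ] at h)
          rw [← Module.End.mul_apply, ← pow_succ, pow_succ', Module.End.mul_apply, hg, map_zero]
        have h2 : z • g ∈ S := by
          have := S.sub_mem (hTS g hg) h1
          simpa using this
        exact (S.smul_mem_iff hz).1 h2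
    exact main k f hk (by rw [hk]; exact S.zero_mem)
  · rw [hS, Submodule.span_le]
    rintro _ ⟨⟨ξ, rfl⟩, rfl⟩
    refine (Module.End.mem_maxGenEigenspace _ _ _).2 ⟨1, ?_⟩
    simp [hTy ξ hz]

theorem finiteDimensional_genEigenspace_and_finrank {T : E →L[ℂ] E} {σ : ι → ℂ}
    {w : ι → StrongDual ℂ E} {y : ι → E}
    (hσ : Summable σ) (hT : ∀ x, HasSum (fun ξ => σ ξ • w ξ x • y ξ) (T x))
    (hw : ∀ ξ, σ ξ ≠ 0 → w ξ (y ξ) = 1)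
    (hne : ∀ ξ η, σ ξ ≠ 0 → σ η ≠ 0 → ξ ≠ η → w ξ (y η) = 0) {z : ℂ} (hz : z ≠ 0) :
    FiniteDimensional ℂ (genEigenspace T z) ∧
      {ξ | σ ξ = z}.encard = (Module.finrank ℂ (genEigenspace T z) : ℕ∞) := by
  rw [genEigenspace_eq_span hσ hT hw hne hz]
  have hfin : {ξ | σ ξ = z}.Finite := by
    have := hσ.tendsto_cofinite_zero.eventually_ne hz.symm
    simpa using this
  have : Fintype {ξ // σ ξ = z} := hfin.fintype
  refine ⟨FiniteDimensional.span_of_finite ℂ (Set.finite_range _), ?_⟩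
  -- Applying the biorthogonal functional `w ξ` to a relation isolates its coefficient at `ξ`.
  have hli : LinearIndependent ℂ fun ξ : {ξ // σ ξ = z} => y ξ := by
    have h0 : ∀ ξ : {ξ // σ ξ = z}, σ ξ ≠ 0 := fun ξ => by rw [ξ.2]; exact hz
    rw [Fintype.linearIndependent_iff]
    intro g hg ξ
    have h1 := congrArg (w ξ) hg
    rw [map_sum, map_zero, Finset.sum_eq_single ξ] at h1
    · simpa [hw ξ (h0 ξ)] using h1
    · intro η _ hη
      simp [hne ξ η (h0 ξ) (h0 η) fun h => hη (Subtype.ext h.symm)]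
    · simp
  rw [finrank_span_eq_card hli, ← hfin.cast_ncard_eq, ← Nat.card_coe_set_eq,
    ← Nat.card_eq_fintype_card]
  rfl

/-- Families with the same nonzero values, counted with multiplicity, have the same sum. -/
theorem hasSum_of_encard_fiber_eq {κ : Type*} {σ : ι → ℂ} {ev : κ → ℂ}
    (h : ∀ z, z ≠ 0 → {j | ev j = z}.encard = {ξ | σ ξ = z}.encard) {t : ℂ}
    (hs : HasSum σ t) : HasSum ev t := by
  have hfin : ∀ z, z ≠ 0 → {ξ | σ ξ = z}.Finite := fun z hz => by
    have := hs.summable.tendsto_cofinite_zero.eventually_ne hz.symm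
    simpa using this
  -- Summability makes the fibers over nonzero values finite; equal `encard` alone would not give a
  -- bijection between infinite fibers.
  have hequiv : ∀ z : {z : ℂ // z ≠ 0}, Nonempty ({j // ev j = z.1} ≃ {ξ // σ ξ = z.1}) := by
    intro z
    have h1 := hfin z z.2
    have h2 : {j | ev j = z.1}.Finite := by
      rw [← Set.encard_lt_top_iff, h z z.2]
      exact h1.encard_lt_top
    have : Finite {j // ev j = z.1} := h2
    have : Finite {ξ // σ ξ = z.1} := h1
    have := Fintype.ofFinite {j // ev j = z.1}
    have := Fintype.ofFinite {ξ // σ ξ = z.1}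
    refine ⟨Fintype.equivOfCardEq ?_⟩
    rw [← Nat.card_eq_fintype_card, ← Nat.card_eq_fintype_card]
    exact congrArg ENat.toNat (h z z.2)
  -- Each support is the disjoint union of its nonzero fibers, so the fiberwise bijections glue to
  -- one between the supports, and unconditional sums are invariant under it.
  let eσ : (Σ z : {z : ℂ // z ≠ 0}, {ξ // σ ξ = z.1}) ≃ Function.support σ :=
    { toFun := fun x => ⟨x.2.1, by simpa [x.2.2] using x.1.2⟩
      invFun := fun ξ => ⟨⟨σ ξ, ξ.2⟩, ⟨ξ.1, rfl⟩⟩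
      left_inv := by rintro ⟨⟨z, hz⟩, ⟨ξ, h⟩⟩; obtain rfl : _ = z := h; rfl
      right_inv := fun _ => rfl }
  let eev : (Σ z : {z : ℂ // z ≠ 0}, {j // ev j = z.1}) ≃ Function.support ev :=
    { toFun := fun x => ⟨x.2.1, by simpa [x.2.2] using x.1.2⟩
      invFun := fun ξ => ⟨⟨ev ξ, ξ.2⟩, ⟨ξ.1, rfl⟩⟩
      left_inv := by rintro ⟨⟨z, hz⟩, ⟨ξ, h⟩⟩; obtain rfl : _ = z := h; rfl
      right_inv := fun _ => rfl }
  have h1 := (hasSum_subtype_support (f := σ)).2 hs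
  rw [← eσ.hasSum_iff] at h1
  rw [← hasSum_subtype_support, ← eev.hasSum_iff,
    ← (Equiv.sigmaCongrRight fun z => (hequiv z).some.symm).hasSum_iff]
  convert h1 using 1
  funext ⟨z, ξ⟩
  exact ((hequiv z).some.symm ξ).2.trans ξ.2.symm

theorem encard_fiber_extend {e : ι → ℕ} (he : e.Injective) (σ : ι → ℂ) {z : ℂ} (hz : z ≠ 0) :
    {j | Function.extend e σ 0 j = z}.encard = {ξ | σ ξ = z}.encard := by
  rw [← he.encard_image]
  congr 1
  ext n
  by_cases hn : ∃ ξ, e ξ = n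
  · obtain ⟨ξ, rfl⟩ := hn
    simp [he.extend_apply, he.eq_iff]
  · have h1 : ∀ ξ, σ ξ = z → e ξ ≠ n := fun ξ _ h => hn ⟨ξ, h⟩
    simpa [Function.extend_apply' _ _ _ hn, hz.symm] using h1

end Spectrum

/-! ### Metric approximation property of `L^p` by conditional expectations. -/

section Approximation

variable {M : Type*} {m m0 : MeasurableSpace M} {μ : Measure M} [IsFiniteMeasure μ]
  {p : ℝ≥0∞} [hp : Fact (1 ≤ p)]

variable (μ p m) in
/-- The conditional expectation as an operator on `Lᵖ`. -/
noncomputable def condExpLp : Lp ℂ p μ →L[ℂ] Lp ℂ p μ :=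
  LinearMap.mkContinuous
    { toFun := fun f => ((Lp.memLp f).condExp (m := m) hp.out).toLp (μ[f | m])
      map_add' := fun f g => by
        rw [← MemLp.toLp_add, MemLp.toLp_eq_toLp_iff]
        exact (condExp_congr_ae (Lp.coeFn_add f g)).trans
          (condExp_add ((Lp.memLp f).integrable hp.out) ((Lp.memLp g).integrable hp.out) m)
      map_smul' := fun c f => by
        rw [RingHom.id_apply, ← MemLp.toLp_const_smul, MemLp.toLp_eq_toLp_iff]
        exact (condExp_congr_ae (Lp.coeFn_smul c f)).trans (condExp_smul c f m) }
    1 fun f => by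
      have h : MemLp (μ[f | m]) p μ := (Lp.memLp f).condExp hp.out
      rw [one_mul, Lp.norm_def f]
      exact (Lp.norm_toLp _ h).trans_le
        (ENNReal.toReal_mono (Lp.eLpNorm_ne_top f) (eLpNorm_condExp_le_eLpNorm _ hp.out))

theorem coeFn_condExpLp (f : Lp ℂ p μ) : condExpLp m μ p f =ᵐ[μ] μ[f | m] :=
  ((Lp.memLp f).condExp hp.out).coeFn_toLp

theorem norm_condExpLp_le : ‖condExpLp m μ p‖ ≤ 1 :=
  LinearMap.mkContinuous_norm_le _ zero_le_one _

theorem condExpLp_eq_self (hm : m ≤ m0) {f : Lp ℂ p μ} (hf : AEStronglyMeasurable[m] f μ) :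
    condExpLp m μ p f = f :=
  Lp.ext ((coeFn_condExpLp f).trans
    (condExp_of_aestronglyMeasurable' hm hf ((Lp.memLp f).integrable hp.out)))

/-- Conditional expectations with respect to finite partitions have finite rank. -/
theorem finiteDimensional_range_condExpLp {β : Type*} [MeasurableSpace β]
    [MeasurableSingletonClass β] {φ : M → β} (hφ : Measurable[m0] φ) (hfin : (Set.range φ).Finite) :
    FiniteDimensional ℂ
      (condExpLp (.comap φ inferInstance) μ p : Lp ℂ p μ →ₗ[ℂ] Lp ℂ p μ).range := by
  let b : β → Lp ℂ p μ := fun c =>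
    indicatorConstLp p (hφ (measurableSet_singleton c)) (measure_ne_top _ _) (1 : ℂ)
  have : FiniteDimensional ℂ (Submodule.span ℂ (b '' Set.range φ)) :=
    FiniteDimensional.span_of_finite ℂ (hfin.image _)
  refine Submodule.finiteDimensional_of_le (S₂ := Submodule.span ℂ (b '' Set.range φ)) ?_
  rintro _ ⟨f, rfl⟩
  -- Measurability for the σ-algebra generated by `φ` makes the conditional expectation a function
  -- of `φ`, hence a combination of the indicators of its finitely many level sets.
  obtain ⟨h, -, hh⟩ := (stronglyMeasurable_condExp (m := .comap φ inferInstance) (μ := μ)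
    (f := f)).exists_eq_measurable_comp
  have : condExpLp (.comap φ inferInstance) μ p f = ∑ c ∈ hfin.toFinset, h c • b c := by
    refine Lp.ext ?_
    have h1 : ∀ᵐ x ∂μ, ∀ c ∈ hfin.toFinset, (h c • b c : Lp ℂ p μ) x
        = h c * (φ ⁻¹' {c}).indicator (fun _ => (1 : ℂ)) x := by
      rw [Finset.eventually_all]
      intro c _
      filter_upwards [Lp.coeFn_smul (h c) (b c), indicatorConstLp_coeFn (p := p)
        (hs := hφ (measurableSet_singleton c)) (hμs := measure_ne_top μ _) (c := (1 : ℂ))]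
        with x hx hx'
      rw [hx, Pi.smul_apply, hx', smul_eq_mul]
    filter_upwards [coeFn_condExpLp (m := .comap φ inferInstance) f, h1,
      Lp.coeFn_finsetSum hfin.toFinset (fun c => h c • b c)] with x hx hx1 hx2
    rw [hx, hx2, Finset.sum_apply, Finset.sum_congr rfl hx1, hh,
      Finset.sum_eq_single (φ x)]
    · simp
    · intro c _ hc
      simp [hc.symm]
    · simp
  rw [ContinuousLinearMap.coe_coe, this]
  exact Submodule.sum_mem _ fun c hc => Submodule.smul_mem _ _
    (Submodule.subset_span ⟨c, by simpa using hc, rfl⟩)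

/-- Approximate the given vectors by simple functions and condition on the partition these generate
jointly. The conditional expectation fixes every approximant and is a contraction, so the error `ε /
2` is counted at most twice. -/
theorem hasMetricApproximation_Lp (hp_top : p ≠ ⊤) : HasMetricApproximation (Lp ℂ p μ) := by
  intro s ε hε
  have h1 : ∀ y : s, ∃ g : Lp.simpleFunc ℂ p μ, ‖(y : Lp ℂ p μ) - g‖ < ε / 2 := fun y => by
    obtain ⟨g, hg⟩ := (Lp.simpleFunc.denseRange (E := ℂ) (μ := μ) hp_top).exists_dist_lt
      (y : Lp ℂ p μ) (half_pos hε)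
    exact ⟨g, by rwa [← dist_eq_norm]⟩
  choose g hg using h1
  let φ : M → s → ℂ := fun x y => Lp.simpleFunc.toSimpleFunc (g y) x
  have hφ : Measurable φ := measurable_pi_lambda _ fun y => (Lp.simpleFunc.toSimpleFunc (g y)).measurable
  have hfin : (Set.range φ).Finite :=
    (Set.Finite.pi' fun y => (Lp.simpleFunc.toSimpleFunc (g y)).finite_range).subset <| by
      rintro _ ⟨x, rfl⟩ y
      exact ⟨x, rfl⟩
  refine ⟨condExpLp (.comap φ inferInstance) μ p, finiteDimensional_range_condExpLp hφ hfin,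
    norm_condExpLp_le, fun y hy => ?_⟩
  set P := condExpLp (.comap φ inferInstance) μ p
  have hP : P (g ⟨y, hy⟩) = g ⟨y, hy⟩ := by
    refine condExpLp_eq_self hφ.comap_le ?_
    refine ⟨fun x => φ x ⟨y, hy⟩, ?_, (Lp.simpleFunc.toSimpleFunc_eq_toFun _).symm⟩
    exact Measurable.stronglyMeasurable
      ((measurable_pi_apply _).comp (comap_measurable φ))
  calc ‖P y - y‖ = ‖P (y - g ⟨y, hy⟩) - (y - g ⟨y, hy⟩)‖ := by rw [map_sub, hP]; congr 1; abel
    _ ≤ ‖P (y - g ⟨y, hy⟩)‖ + ‖y - g ⟨y, hy⟩‖ := norm_sub_le _ _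
    _ ≤ 1 * ‖y - g ⟨y, hy⟩‖ + ‖y - g ⟨y, hy⟩‖ := by
        gcongr
        exact P.le_of_opNorm_le norm_condExpLp_le _
    _ ≤ ε := by linarith [hg ⟨y, hy⟩]

end Approximation

/-! ### The multiplier as a sum of rank one operators and as an integral operator. -/

section Realization

variable {M : Type*} [MeasurableSpace M] {μ : Measure M} {ι : Type*}
  {p q p' : ℝ≥0∞} [Fact (1 ≤ p)] [Fact (1 ≤ q)] [Fact (1 ≤ p')]

/-- The functional `f ↦ ∫ g f` on `Lᵖ` defined by `g` in the conjugate `L^q`. -/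
noncomputable def dualPairing (p : ℝ≥0∞) [Fact (1 ≤ p)] [ENNReal.HolderConjugate q p] :
    Lp ℂ q μ →L[ℂ] StrongDual ℂ (Lp ℂ p μ) :=
  (ContinuousLinearMap.mul ℂ ℂ).lpPairing μ q p

theorem dualPairing_apply [ENNReal.HolderConjugate q p] (g : Lp ℂ q μ) (f : Lp ℂ p μ) :
    dualPairing p g f = ∫ x, g x * f x ∂μ :=
  ContinuousLinearMap.lpPairing_eq_integral _ _ _

theorem dualPairing_apply_of_ae_eq [ENNReal.HolderConjugate q p] {g : Lp ℂ q μ} {f : Lp ℂ p μ}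
    {g' f' : M → ℂ} (hg : g =ᵐ[μ] fun x => conj (g' x)) (hf : f =ᵐ[μ] f') :
    dualPairing p g f = ∫ x, f' x * conj (g' x) ∂μ := by
  rw [dualPairing_apply]
  refine integral_congr_ae ?_
  filter_upwards [hg, hf] with x h1 h2
  rw [h1, h2, mul_comm]

/-- An absolutely convergent series of rank one operators. -/
theorem exists_clm_hasSum_rankOne {E F : Type*} [NormedAddCommGroup E] [NormedSpace ℂ E]
    [NormedAddCommGroup F] [NormedSpace ℂ F] [CompleteSpace F] {w : ι → StrongDual ℂ E} {y : ι → F}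
    (hs : Summable fun ξ => ‖w ξ‖ * ‖y ξ‖) :
    ∃ T : E →L[ℂ] F, ∀ x, HasSum (fun ξ => w ξ x • y ξ) (T x) := by
  have hsT : Summable fun ξ => (w ξ).smulRight (y ξ) :=
    Summable.of_norm (hs.congr fun ξ => (ContinuousLinearMap.norm_smulRight_apply _ _).symm)
  obtain ⟨T, hT⟩ := hsT
  exact ⟨T, fun x => hT.mapL (ContinuousLinearMap.apply ℂ F x)⟩

theorem norm_dualPairing_mul_le [ENNReal.HolderConjugate q p] (σ : ℂ) (W : Lp ℂ q μ)
    (U : Lp ℂ p' μ) : ‖(σ • dualPairing p W : StrongDual ℂ (Lp ℂ p μ))‖ * ‖U‖ ≤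
      ‖dualPairing (q := q) (μ := μ) p‖ * (‖σ‖ * ‖U‖ * ‖W‖) := by
  rw [norm_smul]
  calc ‖σ‖ * ‖dualPairing p W‖ * ‖U‖
      ≤ ‖σ‖ * (‖dualPairing (q := q) (μ := μ) p‖ * ‖W‖) * ‖U‖ := by
        gcongr
        exact (dualPairing p).le_opNorm _
    _ = _ := by ring

/-- A sum of rank one operators is an integral operator. -/
theorem ae_eq_integral_of_hasSum [Countable ι] [ENNReal.HolderConjugate q p] {σ : ι → ℂ}
    {U : ι → Lp ℂ p' μ} {W : ι → Lp ℂ q μ} (hs : Summable fun ξ => ‖σ ξ‖ * ‖U ξ‖ * ‖W ξ‖)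
    {g : Lp ℂ p μ} {b : Lp ℂ p' μ} (hb : HasSum (fun ξ => (σ ξ • dualPairing p (W ξ)) g • U ξ) b) :
    ∀ᵐ x ∂μ, ∀ K : M → ℂ, (K =ᵐ[μ] fun y => ∑' ξ, U ξ x * σ ξ * W ξ y) →
      Integrable (fun y => K y * g y) μ ∧ b x = ∫ y, K y * g y ∂μ := by
  -- The weights `‖σ ξ‖ * ‖W ξ‖` ensure that, for almost every fixed `x`, the kernel section `∑ U ξ
  -- x * σ ξ * W ξ` converges absolutely in `L^q`.
  have h1 : ∀ᵐ x ∂μ, Summable fun ξ => ‖((‖σ ξ‖ * ‖W ξ‖ : ℂ) • U ξ : Lp ℂ p' μ) x‖ := by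
    refine summable_norm_of_tsum_eLpNorm_ne_top (p := p') Fact.out
      (fun ξ => Lp.aestronglyMeasurable _) ?_
    simp_rw [← Lp.enorm_def]
    refine tsum_enorm_ne_top_iff_summable_norm.2 (hs.congr fun ξ => ?_)
    rw [norm_smul, norm_mul, Complex.norm_real, Complex.norm_real, norm_norm, norm_norm]
    ring
  have h2 : ∀ᵐ x ∂μ, HasSum (fun ξ => ((σ ξ • dualPairing p (W ξ)) g • U ξ : Lp ℂ p' μ) x)
      (b x) := by
    rw [← hb.tsum_eq]
    refine Lp.hasSum_coeFn_tsum (tsum_enorm_ne_top_iff_summable_norm.2 ?_)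
    refine Summable.of_norm_bounded
      ((hs.mul_left ‖dualPairing (q := q) (μ := μ) p‖).mul_right ‖g‖) fun ξ => ?_
    rw [norm_norm, norm_smul]
    calc ‖(σ ξ • dualPairing p (W ξ)) g‖ * ‖U ξ‖
        ≤ (‖σ ξ • dualPairing p (W ξ)‖ * ‖g‖) * ‖U ξ‖ := by
          gcongr
          exact ContinuousLinearMap.le_opNorm _ _
      _ = (‖σ ξ • dualPairing p (W ξ)‖ * ‖U ξ‖) * ‖g‖ := by ring
      _ ≤ _ := by
          exact mul_le_mul_of_nonneg_right (norm_dualPairing_mul_le _ _ _) (norm_nonneg g)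
  have h3 : ∀ᵐ x ∂μ, ∀ ξ, ((‖σ ξ‖ * ‖W ξ‖ : ℂ) • U ξ : Lp ℂ p' μ) x = (‖σ ξ‖ * ‖W ξ‖ : ℂ) * U ξ x :=
    ae_all_iff.2 fun ξ => Lp.coeFn_smul _ _
  have h4 : ∀ᵐ x ∂μ, ∀ ξ, ((σ ξ • dualPairing p (W ξ)) g • U ξ : Lp ℂ p' μ) x =
      (σ ξ • dualPairing p (W ξ)) g * U ξ x :=
    ae_all_iff.2 fun ξ => Lp.coeFn_smul _ _
  -- Here `x` is fixed before `K`, so `K` may be a section at `x` that equals the series only for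
  -- almost every `y`.
  filter_upwards [h1, h2, h3, h4] with x h1 h2 h3 h4 K hK
  have hsum : Summable fun ξ => ‖(U ξ x * σ ξ) • W ξ‖ := by
    refine h1.congr fun ξ => ?_
    rw [h3, norm_smul, norm_mul, norm_mul, norm_mul, Complex.norm_real, Complex.norm_real,
      norm_norm, norm_norm]
    ring
  have hk : K =ᵐ[μ] (∑' ξ, (U ξ x * σ ξ) • W ξ : Lp ℂ q μ) := by
    refine hK.trans ?_
    have hsm : ∀ᵐ y ∂μ, ∀ ξ, ((U ξ x * σ ξ) • W ξ : Lp ℂ q μ) y = U ξ x * σ ξ * W ξ y :=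
      ae_all_iff.2 fun ξ => Lp.coeFn_smul _ _
    filter_upwards [Lp.coeFn_tsum (tsum_enorm_ne_top_iff_summable_norm.2 hsum), hsm] with y hy hy'
    rw [hy]
    exact tsum_congr fun ξ => (hy' ξ).symm
  have hkg : (fun y => K y * g y) =ᵐ[μ]
      fun y => (∑' ξ, (U ξ x * σ ξ) • W ξ : Lp ℂ q μ) y * g y := by
    filter_upwards [hk] with y hy
    rw [hy]
  refine ⟨?_, ?_⟩
  · refine Integrable.congr ?_ hkg.symm
    exact (Lp.memLp _).integrable_mul (Lp.memLp g)
  · rw [integral_congr_ae hkg, ← dualPairing_apply]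
    refine h2.unique ?_
    -- Pairing with `g` is continuous on `L^q`; this exchanges sum and integral.
    have h5 := ((dualPairing p).flip g).hasSum hsum.of_norm.hasSum
    refine HasSum.congr_fun h5 fun ξ => ?_
    rw [h4, map_smul, smul_eq_mul, smul_apply, smul_eq_mul, ContinuousLinearMap.flip_apply]
    ring

/-- Convergence in either norm implies convergence in measure, whose limit is unique almost
everywhere. This compares the series for `T g` in `L^{p'}` with the basis expansion in `L²`. -/
theorem Lp_ae_eq_of_hasSum [Countable ι] {f : ι → Lp ℂ p μ} {g : ι → Lp ℂ q μ} {a : Lp ℂ p μ}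
    {b : Lp ℂ q μ} (hf : HasSum f a) (hg : HasSum g b) (h : ∀ ξ, f ξ =ᵐ[μ] g ξ) : a =ᵐ[μ] b := by
  refine tendstoInMeasure_ae_unique (tendstoInMeasure_of_tendsto_Lp hf) ?_
  refine TendstoInMeasure.congr_left (fun s => ?_) (tendstoInMeasure_of_tendsto_Lp hg)
  filter_upwards [Lp.coeFn_finsetSum s f, Lp.coeFn_finsetSum s g, ae_all_iff.2 h] with x h1 h2 h3
  rw [h1, h2, Finset.sum_apply, Finset.sum_apply]
  exact Finset.sum_congr rfl fun ξ _ => (h3 ξ).symm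

/-- The coefficients of the basis expansion are the Fourier coefficients. -/
theorem IsBiorthogonalEigenbasis.hasSum_fourierL {L : Lp ℂ 2 μ →ₗ.[ℂ] Lp ℂ 2 μ} {lam : ι → ℂ}
    {u v : ι → Lp ℂ 2 μ} (hL : IsBiorthogonalEigenbasis L lam u v) (f : Lp ℂ 2 μ) :
    HasSum (fun ξ => fourierL v f ξ • u ξ) f := by
  obtain ⟨a, ha, -⟩ := hL.basis f
  convert ha using 3 with ξ
  have hv : ∀ g : Lp ℂ 2 μ, dualPairing 2 (star (v ξ)) g = ∫ x, g x * conj (v ξ x) ∂μ :=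
    fun g => dualPairing_apply_of_ae_eq (Lp.coeFn_star _) (ae_eq_refl _)
  rw [fourierL, ← hv]
  refine ((dualPairing 2 (star (v ξ))).hasSum ha).unique ?_
  convert hasSum_single ξ _ using 1
  · rw [map_smul, hv, hL.pairing_self, smul_eq_mul, mul_one]
  · intro η hη
    rw [map_smul, hv, hL.pairing_ne η ξ hη, smul_zero]

/-- If the norm is infinite, `F = 0` works because `toReal` sends `⊤` to `0`. -/
theorem exists_Lp_norm_eq (p : ℝ≥0∞) {f : M → ℂ} (hf : AEStronglyMeasurable f μ) :
    ∃ F : Lp ℂ p μ, ‖F‖ = (eLpNorm f p μ).toReal ∧ (eLpNorm f p μ ≠ ⊤ → F =ᵐ[μ] f) := by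
  by_cases h : eLpNorm f p μ = ⊤
  · exact ⟨0, by simp [h], fun h' => absurd h h'⟩
  · have hm : MemLp f p μ := ⟨hf, lt_top_iff_ne_top.2 h⟩
    exact ⟨hm.toLp f, Lp.norm_toLp _ _, fun _ => hm.coeFn_toLp⟩

/-- Since `∫ u ξ * conj (v ξ) = 1`, neither factor vanishes almost everywhere. Hence when `σ ξ ≠ 0`
the convention `0 * ∞ = 0` cannot hide an infinite norm, and finiteness of the sum puts both
functions in the required spaces. -/
theorem IsBiorthogonalEigenbasis.exists_Lp_families {L : Lp ℂ 2 μ →ₗ.[ℂ] Lp ℂ 2 μ} {lam : ι → ℂ}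
    {u v : ι → Lp ℂ 2 μ} (hL : IsBiorthogonalEigenbasis L lam u v) {σ : ι → ℂ} {r : ℝ}
    (hr : 0 < r)
    (hσ : ∑' ξ, ‖σ ξ‖ₑ ^ r * eLpNorm (u ξ) p μ ^ r * eLpNorm (v ξ) q μ ^ r < ⊤) :
    ∃ (U : ι → Lp ℂ p μ) (W : ι → Lp ℂ q μ),
      (∀ ξ, σ ξ ≠ 0 → U ξ =ᵐ[μ] u ξ ∧ W ξ =ᵐ[μ] fun x => conj (v ξ x)) ∧
      Summable fun ξ => (‖σ ξ‖ * ‖U ξ‖ * ‖W ξ‖) ^ r := by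
  have hp : p ≠ 0 := (zero_lt_one.trans_le Fact.out).ne'
  have hq : q ≠ 0 := (zero_lt_one.trans_le Fact.out).ne'
  choose U hU hU' using fun ξ => exists_Lp_norm_eq p (Lp.aestronglyMeasurable (u ξ))
  choose W hW hW' using fun ξ =>
    exists_Lp_norm_eq q (Lp.aestronglyMeasurable (v ξ)).star
  simp only [eLpNorm_star] at hW hW'
  refine ⟨U, W, fun ξ hξ => ?_, ?_⟩
  · have h0 := ENNReal.ne_top_of_tsum_ne_top hσ.ne ξ
    have hs : ‖σ ξ‖ₑ ^ r ≠ 0 := by simp [hξ, hr.not_gt]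
    have hu : eLpNorm (u ξ) p μ ≠ 0 := fun h => by
      rw [eLpNorm_eq_zero_iff (Lp.aestronglyMeasurable _) hp] at h
      refine one_ne_zero ((hL.pairing_self ξ).symm.trans (integral_eq_zero_of_ae ?_))
      filter_upwards [h] with x hx
      simp [hx]
    have hv : eLpNorm (v ξ) q μ ≠ 0 := fun h => by
      rw [eLpNorm_eq_zero_iff (Lp.aestronglyMeasurable _) hq] at h
      refine one_ne_zero ((hL.pairing_self ξ).symm.trans (integral_eq_zero_of_ae ?_))
      filter_upwards [h] with x hx
      simp [hx]
    refine ⟨hU' ξ fun h => h0 ?_, hW' ξ fun h => h0 ?_⟩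
    · rw [h, ENNReal.top_rpow_of_pos hr, ENNReal.mul_top hs, ENNReal.top_mul]
      simp [hv, hr.not_gt]
    · rw [h, ENNReal.top_rpow_of_pos hr, ENNReal.mul_top]
      exact mul_ne_zero hs (by simp [hu, hr.not_gt])
  · refine (ENNReal.summable_toReal hσ.ne).congr fun ξ => ?_
    rw [ENNReal.toReal_mul, ENNReal.toReal_mul, ← ENNReal.toReal_rpow, ← ENNReal.toReal_rpow,
      ← ENNReal.toReal_rpow, ← hU, ← hW, toReal_enorm]
    rw [← Real.mul_rpow (norm_nonneg _) (norm_nonneg _),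
      ← Real.mul_rpow (mul_nonneg (norm_nonneg _) (norm_nonneg _)) (norm_nonneg _)]

theorem IsLpRealization.unique {L : Lp ℂ 2 μ →ₗ.[ℂ] Lp ℂ 2 μ} {u v : ι → Lp ℂ 2 μ}
    {A : TestSpace L →L[ℂ] TestSpace L} {σ : ι → ℂ} {T T' : Lp ℂ p μ →L[ℂ] Lp ℂ q μ}
    (h : IsLpRealization u v A σ T) (h' : IsLpRealization u v A σ T') : T = T' := by
  refine ContinuousLinearMap.ext fun g => Lp.ext ?_
  filter_upwards [h.kernel_eq g, h'.kernel_eq g] with x h1 h2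
  rw [h1.2, h2.2]

/-- The realization of a Fourier multiplier, with its expansion in rank one operators. -/
theorem exists_isLpRealization [Countable ι] [ENNReal.HolderConjugate q p]
    {L : Lp ℂ 2 μ →ₗ.[ℂ] Lp ℂ 2 μ} {lam : ι → ℂ} {u v : ι → Lp ℂ 2 μ}
    (hL : IsBiorthogonalEigenbasis L lam u v) {A : TestSpace L →L[ℂ] TestSpace L} {σ : ι → ℂ}
    (hA : IsFourierMultiplier v A σ) {U : ι → Lp ℂ p' μ} {W : ι → Lp ℂ q μ}
    (hUW : ∀ ξ, σ ξ ≠ 0 → U ξ =ᵐ[μ] u ξ ∧ W ξ =ᵐ[μ] fun x => conj (v ξ x))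
    (hs : Summable fun ξ => ‖σ ξ‖ * ‖U ξ‖ * ‖W ξ‖) :
    ∃ T : Lp ℂ p μ →L[ℂ] Lp ℂ p' μ, IsLpRealization u v A σ T ∧
      ∀ g, HasSum (fun ξ => (σ ξ • dualPairing p (W ξ)) g • U ξ) (T g) := by
  obtain ⟨T, hT⟩ := exists_clm_hasSum_rankOne (w := fun ξ => σ ξ • dualPairing p (W ξ)) (y := U)
    (Summable.of_nonneg_of_le (fun ξ => mul_nonneg (norm_nonneg _) (norm_nonneg _))
      (fun ξ => norm_dualPairing_mul_le (p := p) _ _ _)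
      (hs.mul_left ‖dualPairing (q := q) (μ := μ) p‖))
  have hU : ∀ᵐ x ∂μ, ∀ ξ, σ ξ ≠ 0 → U ξ x = u ξ x := ae_all_iff.2 fun ξ => by
    by_cases h : σ ξ = 0
    · simp [h]
    · filter_upwards [(hUW ξ h).1] with x hx _ using hx
  have hW : ∀ᵐ x ∂μ, ∀ ξ, σ ξ ≠ 0 → W ξ x = conj (v ξ x) := ae_all_iff.2 fun ξ => by
    by_cases h : σ ξ = 0
    · simp [h]
    · filter_upwards [(hUW ξ h).2] with x hx _ using hx
  refine ⟨T, ⟨fun f g hfg => ?_, fun g => ?_⟩, hT⟩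
  -- The multiplier identity turns the `L²` coefficients of `A f` into `σ ξ * f̂(ξ)`, which are the
  -- coefficients of the series for `T g`.
  · refine Lp_ae_eq_of_hasSum (hT g) (hL.hasSum_fourierL (TestSpace.incl L (A f))) fun ξ => ?_
    rw [hA f ξ]
    by_cases h : σ ξ = 0
    · rw [smul_apply, smul_eq_mul, h, zero_mul, zero_mul, zero_smul, zero_smul]
      exact (Lp.coeFn_zero ℂ p' μ).trans (Lp.coeFn_zero ℂ 2 μ).symm
    · rw [smul_apply, smul_eq_mul, dualPairing_apply_of_ae_eq (hUW ξ h).2 hfg]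
      refine (Lp.coeFn_smul _ _).trans (EventuallyEq.trans ?_ (Lp.coeFn_smul _ _).symm)
      filter_upwards [(hUW ξ h).1] with x hx
      simp [hx, fourierL]
  · filter_upwards [ae_eq_integral_of_hasSum hs (hT g), hU] with x hx hux
    refine hx (kernel u v σ x) ?_
    filter_upwards [hW] with y hy
    refine tsum_congr fun ξ => ?_
    by_cases h : σ ξ = 0
    · simp [h]
    · rw [hux ξ h, hy ξ h]

end Realization

end NonharmonicAnalysis

/-! ### Assembly of the main theorem. -/

open NonharmonicAnalysis in
theorem corollary3p3
    {E : Type*} [NormedAddCommGroup E] [NormedSpace ℝ E] [FiniteDimensional ℝ E]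
    {H : Type*} [TopologicalSpace H] (J : ModelWithCorners ℝ E H)
    {M : Type*} [TopologicalSpace M] [T2Space M] [CompactSpace M]
    [ChartedSpace H M] [IsManifold J ∞ M]
    [MeasurableSpace M] [BorelSpace M] (μ : Measure M) [IsFiniteMeasure μ]
    {ι : Type*} [Countable ι]
    (L : Lp ℂ 2 μ →ₗ.[ℂ] Lp ℂ 2 μ) (lam : ι → ℂ) (u v : ι → Lp ℂ 2 μ)
    (hL : NonharmonicAnalysis.IsBiorthogonalEigenbasis L lam u v)
    (A : NonharmonicAnalysis.TestSpace L →L[ℂ] NonharmonicAnalysis.TestSpace L) (σ : ι → ℂ)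
    (hA : NonharmonicAnalysis.IsFourierMultiplier v A σ)
    (r : ℝ) (hr0 : 0 < r) (hr1 : r ≤ 1)
    (p₁ p₂ q₁ : ℝ≥0∞) [Fact (1 ≤ p₁)] [Fact (1 ≤ p₂)] (hp₁ : p₁ ≠ ⊤) (hp₂ : p₂ ≠ ⊤)
    (hq₁ : p₁⁻¹ + q₁⁻¹ = 1)
    (hσ : ∑' ξ, ‖σ ξ‖ₑ ^ r * eLpNorm (u ξ) p₂ μ ^ r * eLpNorm (v ξ) q₁ μ ^ r < ⊤) :
    (∃! T : Lp ℂ p₁ μ →L[ℂ] Lp ℂ p₂ μ, NonharmonicAnalysis.IsLpRealization u v A σ T) ∧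
    (∀ T : Lp ℂ p₁ μ →L[ℂ] Lp ℂ p₂ μ, NonharmonicAnalysis.IsLpRealization u v A σ T →
      NonharmonicAnalysis.IsRNuclear r T) ∧
    (p₁ = p₂ → ∀ T : Lp ℂ p₁ μ →L[ℂ] Lp ℂ p₁ μ,
      NonharmonicAnalysis.IsLpRealization u v A σ T →
        Summable σ ∧
        NonharmonicAnalysis.HasNuclearTrace T (∑' ξ, σ ξ) ∧
        (∃ ev : ℕ → ℂ, NonharmonicAnalysis.IsEigenvalueSequence T ev) ∧
        ∀ ev : ℕ → ℂ, NonharmonicAnalysis.IsEigenvalueSequence T ev →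
          HasSum ev (∑' ξ, σ ξ)) := by
  have : ENNReal.HolderConjugate q₁ p₁ := ⟨by rw [add_comm, hq₁, inv_one]⟩
  have : Fact (1 ≤ q₁) := ⟨ENNReal.HolderConjugate.one_le q₁ p₁⟩
  obtain ⟨e, he⟩ := Countable.exists_injective_nat ι
  obtain ⟨U, W, hUW, hsr⟩ := hL.exists_Lp_families hr0 hσ
  have hs : Summable fun ξ => ‖σ ξ‖ * ‖U ξ‖ * ‖W ξ‖ :=
    summable_of_summable_rpow hr0 hr1 (fun ξ => by positivity) hsr
  obtain ⟨T₀, hT₀, hT₀'⟩ := exists_isLpRealization (p := p₁) hL hA hUW hs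
  let w : ι → StrongDual ℂ (Lp ℂ p₁ μ) := fun ξ => σ ξ • dualPairing p₁ (W ξ)
  have hw : Summable fun ξ => ‖w ξ‖ ^ r * ‖U ξ‖ ^ r := by
    refine Summable.of_nonneg_of_le (fun ξ => by positivity) (fun ξ => ?_)
      (hsr.mul_left (‖dualPairing (q := q₁) (μ := μ) p₁‖ ^ r))
    rw [← Real.mul_rpow (norm_nonneg _) (norm_nonneg _),
      ← Real.mul_rpow (norm_nonneg (dualPairing (q := q₁) (μ := μ) p₁)) (by positivity)]
    exact Real.rpow_le_rpow (by positivity) (norm_dualPairing_mul_le _ _ _) hr0.le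
  refine ⟨⟨T₀, hT₀, fun T hT => hT.unique hT₀⟩, fun T hT => ?_, ?_⟩
  · rw [hT.unique hT₀]
    exact ⟨_, _, isNuclearRep_extend hr0 hT₀' hw he⟩
  rintro rfl T hT
  obtain rfl := hT.unique hT₀
  have hw1 : Summable fun ξ => ‖w ξ‖ ^ (1 : ℝ) * ‖U ξ‖ ^ (1 : ℝ) := by
    simp only [Real.rpow_one]
    refine summable_of_summable_rpow hr0 hr1 (fun ξ => by positivity) (hw.congr fun ξ => ?_)
    rw [Real.mul_rpow (norm_nonneg _) (norm_nonneg _)]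
  have hself : ∀ ξ, σ ξ ≠ 0 → dualPairing p₁ (W ξ) (U ξ) = 1 := fun ξ h => by
    rw [dualPairing_apply_of_ae_eq (hUW ξ h).2 (hUW ξ h).1, hL.pairing_self]
  have hne : ∀ ξ η, σ ξ ≠ 0 → σ η ≠ 0 → ξ ≠ η → dualPairing p₁ (W ξ) (U η) = 0 :=
    fun ξ η h h' hξη => by
      rw [dualPairing_apply_of_ae_eq (hUW ξ h).2 (hUW η h').1, hL.pairing_ne η ξ hξη.symm]
  -- These are the diagonal terms of the trace; they also bound `‖σ ξ‖` by `‖w ξ‖ * ‖U ξ‖`, which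
  -- gives summability of `σ`.
  have hwU : ∀ ξ, w ξ (U ξ) = σ ξ := fun ξ => by
    by_cases h : σ ξ = 0
    · simp [w, h]
    · simp [w, hself ξ h]
  have hσs : Summable σ := by
    refine Summable.of_norm_bounded hw1 fun ξ => ?_
    rw [Real.rpow_one, Real.rpow_one, ← hwU ξ]
    exact (w ξ).le_opNorm _
  have hev : ∀ z : ℂ, z ≠ 0 → FiniteDimensional ℂ (genEigenspace T z) ∧
      {ξ | σ ξ = z}.encard = (Module.finrank ℂ (genEigenspace T z) : ℕ∞) := fun z hz =>
    finiteDimensional_genEigenspace_and_finrank hσs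
      (fun x => (hT₀' x).congr_fun fun ξ => (smul_assoc _ _ _).symm) hself hne hz
  -- The witness lists the values of `σ` along `e`, padded with zeros, which do not affect fibers
  -- over `z ≠ 0`.
  refine ⟨hσs, ?_, ⟨Function.extend e σ 0, fun z hz => ?_⟩, fun ev h => ?_⟩
  · convert (isNuclearRep_extend one_pos hT₀' hw1 he).hasNuclearTrace
      (hasMetricApproximation_Lp hp₁) using 1
    rw [← tsum_extend_zero he]
    refine tsum_congr fun n => ?_
    by_cases hn : ∃ ξ, e ξ = n
    · obtain ⟨ξ, rfl⟩ := hn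
      simp only [he.extend_apply]
      exact (hwU ξ).symm
    · simp [Function.extend_apply' _ _ _ hn]
  · rw [encard_fiber_extend he σ hz]
    exact hev z hz
  · exact hasSum_of_encard_fiber_eq (fun z hz => (h z hz).2.trans (hev z hz).2.symm) hσs.hasSum
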